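/- Let $f=xyz(x+y+z)$, a real quartic form on $\mathbf R^3$. Its index cone is the set of points of $\mathbf R^3$ at which $f>0$ and the Hessian matrix $(\partial^2 f/\partial x_i\partial x_j)$ has signature $(1,2)$. Then: 1. The index cone of $f$ is nonempty; in fact it is equal to $\{f>0\}$. 2. The level set $M=\{f=1\}$ inside the index cone is a nonempty smooth surface in $\mathbf R^3$, on which the Hessian metric $$g_{ij}=-\frac{1}{4\cdot 3}\,\frac{\partial^2 f}{\partial x_i\,\partial x_j}$$ restricts to a Riemannian metric, and the Gaussian curvature of $M$ with this Riemannian metric is positive at every point of $M$. 3. Let $S(f)$ be the Clebsch covariant of $f$, that is, $$\begin{aligned}S(f)={}&-(a_0a_2-a_1^2)c_1^2+(a_0a_3-a_1a_2)c_0c_1-(a_1a_3-a_2^2)c_0^2-b_0^2a_3c_1+b_0b_1(3a_2c_1+a_3c_0)\\&-(b_0b_2+2b_1^2)(a_1c_1+a_2c_0)+b_1b_2(a_0c_1+3a_1c_0)-b_2^2a_0c_0\\&+d_0\bigl[b_0(a_1a_3-a_2^2)-b_1(a_0a_3-a_1a_2)+b_2(a_0a_2-a_1^2)\bigr]+(b_0b_2-b_1^2)^2,\end{aligned}$$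 where $a_0=f_{111}$, $a_1=f_{113}$, $a_2=f_{133}$, $a_3=f_{333}$, $b_0=f_{112}$, $b_1=f_{123}$, $b_2=f_{233}$, $c_0=f_{122}$, $c_1=f_{223}$, $d_0=f_{222}$ are the third partial derivatives of $f$, with $(x_1,x_2,x_3)=(x,y,z)$. Then, as polynomials, $$S(f)-16\,(x^2+y^2+z^2+xy+xz+yz)^2=48f.$$ -/

import Mathlib

open scoped Matrix ContDiff

noncomputable section

/-! ### Forms, Hessians and the index cone -/

/-- The matrix of second partial derivatives of the polynomial `f`, evaluated at `x`. -/
def hessianMatrix {n : ℕ} (f : MvPolynomial (Fin n) ℝ) (x : Fin n → ℝ) :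
    Matrix (Fin n) (Fin n) ℝ :=
  Matrix.of fun i j => MvPolynomial.eval x (MvPolynomial.pderiv i (MvPolynomial.pderiv j f))

/-- The index cone of `f`: the points where `f` is positive and where the Hessian quadratic form
`v ↦ ∑ i j, (∂²f/∂xᵢ∂xⱼ)(x) vᵢ vⱼ` has signature `(1, n - 1)`. -/
def indexCone {n : ℕ} (f : MvPolynomial (Fin n) ℝ) : Set (Fin n → ℝ) :=
  {x | 0 < MvPolynomial.eval x f ∧
    sigPos (hessianMatrix f x).toQuadraticForm' = 1 ∧
    sigNeg (hessianMatrix f x).toQuadraticForm' = n - 1}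

/-- The level set `{f = 1}` inside the index cone. -/
def unitLevel {n : ℕ} (f : MvPolynomial (Fin n) ℝ) : Set (Fin n → ℝ) :=
  {x | x ∈ indexCone f ∧ MvPolynomial.eval x f = 1}

/-- The Hessian metric `g_{ij} = -1/(d(d-1)) ∂²f/∂xᵢ∂xⱼ` of a form `f` of degree `d`. -/
def hessianMetric {n : ℕ} (d : ℕ) (f : MvPolynomial (Fin n) ℝ) (x : Fin n → ℝ) :
    Matrix (Fin n) (Fin n) ℝ :=
  (-(1 / ((d : ℝ) * ((d : ℝ) - 1)))) • hessianMatrix f x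

/-- The Clebsch covariant `S(f)` of a ternary form `f` (the variables `x₁, x₂, x₃` are numbered
`0, 1, 2`): the polynomial expression of the Aronhold invariant, evaluated at the third partial
derivatives of `f`. -/
def clebschCovariant (f : MvPolynomial (Fin 3) ℝ) : MvPolynomial (Fin 3) ℝ :=
  let t : Fin 3 → Fin 3 → Fin 3 → MvPolynomial (Fin 3) ℝ := fun i j k =>
    MvPolynomial.pderiv i (MvPolynomial.pderiv j (MvPolynomial.pderiv k f))
  let a0 := t 0 0 0
  let a1 := t 0 0 2
  let a2 := t 0 2 2
  let a3 := t 2 2 2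
  let b0 := t 0 0 1
  let b1 := t 0 1 2
  let b2 := t 1 2 2
  let c0 := t 0 1 1
  let c1 := t 1 1 2
  let d0 := t 1 1 1
  (a1 ^ 2 - a0 * a2) * c1 ^ 2 + (a0 * a3 - a1 * a2) * c0 * c1 - (a1 * a3 - a2 ^ 2) * c0 ^ 2
    - b0 ^ 2 * a3 * c1 + b0 * b1 * (3 * a2 * c1 + a3 * c0)
    - (b0 * b2 + 2 * b1 ^ 2) * (a1 * c1 + a2 * c0)
    + b1 * b2 * (a0 * c1 + 3 * a1 * c0) - b2 ^ 2 * a0 * c0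
    + d0 * (b0 * (a1 * a3 - a2 ^ 2) - b1 * (a0 * a3 - a1 * a2) + b2 * (a0 * a2 - a1 ^ 2))
    + (b0 * b2 - b1 ^ 2) ^ 2

/-! ### Curvature of a metric in local coordinates -/

/-- The partial derivative `∂F/∂uᵢ` of a real function on `ℝᵐ`. -/
def partialDeriv {m : ℕ} (i : Fin m) (F : (Fin m → ℝ) → ℝ) (u : Fin m → ℝ) : ℝ :=
  fderiv ℝ F u (Pi.single i 1)

/-- Christoffel symbols of the first kind,
`Γ_{ijk} = (g_{ij,k} + g_{jk,i} - g_{ik,j}) / 2`. -/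
def christoffelFirst {m : ℕ} (g : (Fin m → ℝ) → Matrix (Fin m) (Fin m) ℝ) (i j k : Fin m)
    (u : Fin m → ℝ) : ℝ :=
  (partialDeriv k (fun w => g w i j) u + partialDeriv i (fun w => g w j k) u
    - partialDeriv j (fun w => g w i k) u) / 2

/-- The Riemann curvature tensor
`R_{ijkl} = -(g_{ik,jl} + g_{jl,ik} - g_{il,jk} - g_{jk,il}) / 2
  - ∑ p q, g^{pq} (Γ_{jpl} Γ_{iqk} - Γ_{ipl} Γ_{jqk})`.
With this sign convention, the round sphere has positive `R_{1212}`. -/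
def riemannTensor {m : ℕ} (g : (Fin m → ℝ) → Matrix (Fin m) (Fin m) ℝ) (i j k l : Fin m)
    (u : Fin m → ℝ) : ℝ :=
  -(partialDeriv l (partialDeriv j fun w => g w i k) u
      + partialDeriv k (partialDeriv i fun w => g w j l) u
      - partialDeriv k (partialDeriv j fun w => g w i l) u
      - partialDeriv l (partialDeriv i fun w => g w j k) u) / 2
    - ∑ p, ∑ q, (g u)⁻¹ p q *
        (christoffelFirst g j p l u * christoffelFirst g i q k u
          - christoffelFirst g i p l u * christoffelFirst g j q k u)

/-- The Gaussian (= sectional) curvature `R_{1212} / (g₁₁ g₂₂ - g₁₂²)` of a metric on an open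
subset of `ℝ²`. -/
def gaussianCurvature (g : (Fin 2 → ℝ) → Matrix (Fin 2) (Fin 2) ℝ) (u : Fin 2 → ℝ) : ℝ :=
  riemannTensor g 0 1 0 1 u / (g u 0 0 * g u 1 1 - g u 0 1 ^ 2)

/-! ### Surfaces in `ℝⁿ` -/

/-- The Jacobian matrix of `φ` at `u`. -/
def jacobian {m n : ℕ} (φ : (Fin m → ℝ) → (Fin n → ℝ)) (u : Fin m → ℝ) :
    Matrix (Fin n) (Fin m) ℝ :=
  Matrix.of fun a i => fderiv ℝ φ u (Pi.single i 1) a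

/-- The pullback `φ^* g` of a metric `g` on `ℝⁿ`, in the coordinates of `ℝᵐ`. -/
def pullbackMetric {m n : ℕ} (g : (Fin n → ℝ) → Matrix (Fin n) (Fin n) ℝ)
    (φ : (Fin m → ℝ) → (Fin n → ℝ)) (u : Fin m → ℝ) : Matrix (Fin m) (Fin m) ℝ :=
  (jacobian φ u)ᵀ * g (φ u) * jacobian φ u

/-- `φ`, restricted to the open set `U ⊆ ℝ²`, is a local parametrization of the surface
`M ⊆ ℝⁿ`: a smooth immersion which is a homeomorphism of `U` onto a relatively open subset
of `M`. -/
structure IsLocalParam {n : ℕ} (M : Set (Fin n → ℝ)) (U : Set (Fin 2 → ℝ))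
    (φ : (Fin 2 → ℝ) → (Fin n → ℝ)) : Prop where
  isOpen_domain : IsOpen U
  smooth : ContDiffOn ℝ ∞ φ U
  immersion : ∀ u ∈ U, Function.Injective (fderiv ℝ φ u)
  embedding : Topology.IsEmbedding (U.domRestrict φ)
  open_image : ∃ V : Set (Fin n → ℝ), IsOpen V ∧ φ '' U = M ∩ V

/-- `M` is a smooth (embedded) surface in `ℝⁿ`. -/
def IsSmoothSurface {n : ℕ} (M : Set (Fin n → ℝ)) : Prop :=
  ∀ p ∈ M, ∃ (U : Set (Fin 2 → ℝ)) (φ : (Fin 2 → ℝ) → (Fin n → ℝ)),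
    IsLocalParam M U φ ∧ p ∈ φ '' U

/-- The symmetric bilinear forms `g` on `ℝⁿ` restrict to a Riemannian metric on the surface `M`:
the restriction is positive definite in every local parametrization. -/
def IsRiemannianOn {n : ℕ} (g : (Fin n → ℝ) → Matrix (Fin n) (Fin n) ℝ)
    (M : Set (Fin n → ℝ)) : Prop :=
  ∀ (U : Set (Fin 2 → ℝ)) (φ : (Fin 2 → ℝ) → (Fin n → ℝ)), IsLocalParam M U φ →
    ∀ u ∈ U, (pullbackMetric g φ u).PosDef

/-- The surface `M`, with the restriction of `g`, has Gaussian curvature `κ` at `p`: there is a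
local parametrization around `p`, and the curvature computed in any of them is `κ`. -/
def HasGaussianCurvatureAt {n : ℕ} (g : (Fin n → ℝ) → Matrix (Fin n) (Fin n) ℝ)
    (M : Set (Fin n → ℝ)) (p : Fin n → ℝ) (κ : ℝ) : Prop :=
  (∃ (U : Set (Fin 2 → ℝ)) (φ : (Fin 2 → ℝ) → (Fin n → ℝ)), IsLocalParam M U φ ∧ p ∈ φ '' U) ∧
  ∀ (U : Set (Fin 2 → ℝ)) (φ : (Fin 2 → ℝ) → (Fin n → ℝ)), IsLocalParam M U φ →
    ∀ u ∈ U, φ u = p → gaussianCurvature (pullbackMetric g φ) u = κ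

/-- The real ternary quartic form `xyz(x + y + z)`. -/
def quarticForm : MvPolynomial (Fin 3) ℝ :=
  MvPolynomial.X 0 * MvPolynomial.X 1 * MvPolynomial.X 2 *
    (MvPolynomial.X 0 + MvPolynomial.X 1 + MvPolynomial.X 2)

end

/-! ### The form `xyz(x + y + z)` and its four linear factors -/

/-! Write `f = -∏ l`, a product of four linear forms with sum zero. Logarithmic differentiation
gives `Hess f = f ((∑ dl/l)² - ∑ (dl/l)²)`, and `∑ dl/l = df/f` vanishes on vectors tangent to a
level set. So where `f > 0` the Hessian form is negative definite on a tangent plane, while Euler's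
relation makes it positive on the radial vector. This gives signature (1,2) and the Riemannian
metric together (`indexCone_quarticForm`, `isRiemannianOn_hessianMetric_quarticForm`).

On `f = 1` the same formula says that the metric is `1/12` of the Euclidean metric pulled back by
the functions `log |l|` (`IsLocalParam.pullbackMetric_hessianMetric`). Their sum is zero, so the
surface sits in a Euclidean 3-space inside `ℝ⁴`. There the vector `x` of the four values of the `l`
is normal to it, because `∑ l = 0` differentiates to `∑ x_l d(log |l|) = 0`. Differentiating once
more, the second fundamental form is `-∑ x_l T_l² / |x|`. By `det_weighted_mul_dotProduct_self` and
`∏ l = -1`, its determinant relative to the Euclidean metric is `4 / |x|⁴`, and the Gauss equation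
(`riemannTensor_induced`) with the factor `1/12` gives curvature `48 / |x|⁴ > 0`.

Charts come from radial projection to the plane `x = 1`; the Clebsch identity is a direct expansion.
-/

/-- The linear factors `x, y, z, -(x + y + z)` of `-xyz(x + y + z)`; their sum is zero. -/
noncomputable def linearFactor : Fin 4 → ((Fin 3 → ℝ) →L[ℝ] ℝ) :=
  let x (i : Fin 3) : (Fin 3 → ℝ) →L[ℝ] ℝ := ContinuousLinearMap.proj i
  ![x 0, x 1, x 2, -(x 0 + x 1 + x 2)]

@[simp] lemma linearFactor_zero (v : Fin 3 → ℝ) : linearFactor 0 v = v 0 := rfl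

@[simp] lemma linearFactor_one (v : Fin 3 → ℝ) : linearFactor 1 v = v 1 := rfl

@[simp] lemma linearFactor_two (v : Fin 3 → ℝ) : linearFactor 2 v = v 2 := rfl

@[simp] lemma linearFactor_three (v : Fin 3 → ℝ) :
    linearFactor 3 v = -(v 0 + v 1 + v 2) := rfl

lemma sum_linearFactor (v : Fin 3 → ℝ) : ∑ l, linearFactor l v = 0 := by
  simp only [Fin.sum_univ_four, linearFactor_zero, linearFactor_one, linearFactor_two,
    linearFactor_three]
  ring

lemma eval_quarticForm (p : Fin 3 → ℝ) :
    MvPolynomial.eval p quarticForm = p 0 * p 1 * p 2 * (p 0 + p 1 + p 2) := by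
  simp [quarticForm]

lemma eval_quarticForm_eq_neg_prod (p : Fin 3 → ℝ) :
    MvPolynomial.eval p quarticForm = -∏ l, linearFactor l p := by
  simp only [eval_quarticForm, Fin.prod_univ_four, linearFactor_zero, linearFactor_one,
    linearFactor_two, linearFactor_three]
  ring

lemma linearFactor_ne_zero {p : Fin 3 → ℝ} (hp : MvPolynomial.eval p quarticForm ≠ 0)
    (l : Fin 4) : linearFactor l p ≠ 0 := by
  rw [eval_quarticForm_eq_neg_prod, neg_ne_zero, Finset.prod_ne_zero_iff] at hp
  exact hp l (Finset.mem_univ l)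

lemma hessianMatrix_quarticForm (p : Fin 3 → ℝ) :
    hessianMatrix quarticForm p =
      !![2 * p 1 * p 2, p 2 * (2 * p 0 + 2 * p 1 + p 2), p 1 * (2 * p 0 + p 1 + 2 * p 2);
        p 2 * (2 * p 0 + 2 * p 1 + p 2), 2 * p 0 * p 2, p 0 * (p 0 + 2 * p 1 + 2 * p 2);
        p 1 * (2 * p 0 + p 1 + 2 * p 2), p 0 * (p 0 + 2 * p 1 + 2 * p 2), 2 * p 0 * p 1] := by
  ext i j
  fin_cases i <;> fin_cases j <;>
    simp [hessianMatrix, quarticForm, Derivation.leibniz, MvPolynomial.pderiv_X, Pi.single_apply,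
      smul_eq_mul] <;> ring

/-- The Hessian bilinear form of `xyz(x + y + z)` in logarithmic coordinates. -/
lemma dotProduct_hessianMatrix_quarticForm_mulVec {p : Fin 3 → ℝ}
    (hp : MvPolynomial.eval p quarticForm ≠ 0) (a b : Fin 3 → ℝ) :
    a ⬝ᵥ hessianMatrix quarticForm p *ᵥ b = MvPolynomial.eval p quarticForm *
      ((∑ l, linearFactor l a / linearFactor l p) * (∑ l, linearFactor l b / linearFactor l p)
        - ∑ l, linearFactor l a / linearFactor l p * (linearFactor l b / linearFactor l p)) := by
  have h := linearFactor_ne_zero hp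
  have h0 := h 0
  have h1 := h 1
  have h2 := h 2
  have h3 := h 3
  simp only [linearFactor_zero, linearFactor_one, linearFactor_two, linearFactor_three,
    neg_ne_zero] at h0 h1 h2 h3
  rw [hessianMatrix_quarticForm, eval_quarticForm]
  simp only [dotProduct, Matrix.mulVec, Fin.sum_univ_three, Fin.sum_univ_four, linearFactor_zero,
    linearFactor_one, linearFactor_two, linearFactor_three, neg_div_neg_eq,
    Matrix.of_apply, Matrix.cons_val]
  field_simp
  ring

/-- On the tangent space of a level set, the Hessian form of `xyz(x + y + z)` is negative
definite where the form is positive. -/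
lemma dotProduct_hessianMatrix_quarticForm_mulVec_neg {p : Fin 3 → ℝ}
    (hp : 0 < MvPolynomial.eval p quarticForm) {v : Fin 3 → ℝ} (hv : v ≠ 0)
    (htan : ∑ l, linearFactor l v / linearFactor l p = 0) :
    v ⬝ᵥ hessianMatrix quarticForm p *ᵥ v < 0 := by
  rw [dotProduct_hessianMatrix_quarticForm_mulVec hp.ne', htan, zero_mul, zero_sub]
  refine mul_neg_of_pos_of_neg hp (neg_neg_of_pos ?_)
  have hnn : ∀ l ∈ Finset.univ, 0 ≤ linearFactor l v / linearFactor l p *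
      (linearFactor l v / linearFactor l p) := fun l _ => mul_self_nonneg _
  refine (Finset.sum_nonneg hnn).lt_of_ne fun h0 => hv ?_
  have hz : ∀ l, linearFactor l v = 0 := fun l => by
    have := (Finset.sum_eq_zero_iff_of_nonneg hnn).1 h0.symm l (Finset.mem_univ l)
    simpa [linearFactor_ne_zero hp.ne' l] using this
  ext a
  fin_cases a
  · simpa using hz 0
  · simpa using hz 1
  · simpa using hz 2

/-- Euler's relation in degree 4, with `4 * 3 = 12`; it supplies the positive direction of the
Hessian. -/
lemma dotProduct_hessianMatrix_quarticForm_mulVec_self (p : Fin 3 → ℝ) :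
    p ⬝ᵥ hessianMatrix quarticForm p *ᵥ p = 12 * MvPolynomial.eval p quarticForm := by
  rw [hessianMatrix_quarticForm, eval_quarticForm]
  simp only [dotProduct, Matrix.mulVec, Fin.sum_univ_three, Matrix.of_apply, Matrix.cons_val]
  ring

lemma toQuadraticForm'_apply_eq_dotProduct {n : ℕ} (A : Matrix (Fin n) (Fin n) ℝ)
    (v : Fin n → ℝ) : A.toQuadraticForm' v = v ⬝ᵥ A *ᵥ v := by
  simp [Matrix.toQuadraticForm', Matrix.toLinearMap₂'_apply']

lemma indexCone_quarticForm :
    indexCone quarticForm = {p | 0 < p 0 * p 1 * p 2 * (p 0 + p 1 + p 2)} := by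
  ext p
  simp only [indexCone, Set.mem_ofPred_eq, ← eval_quarticForm]
  refine ⟨fun h => h.1, fun hp => ⟨hp, ?_⟩⟩
  set Q := (hessianMatrix quarticForm p).toQuadraticForm' with hQ
  have hp0 : p ≠ 0 := by
    rintro rfl
    rw [eval_quarticForm] at hp
    simp at hp
  have hpos : 1 ≤ sigPos Q := by
    rw [← finrank_span_singleton (K := ℝ) hp0]
    refine le_sigPos_of_posDef Q fun v hv => ?_
    obtain ⟨c, hc⟩ := Submodule.mem_span_singleton.1 v.2
    have hc0 : c ≠ 0 := by
      rintro rfl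
      exact hv (Subtype.ext (by simpa using hc.symm))
    have hQp : 0 < Q p := by
      rw [hQ, toQuadraticForm'_apply_eq_dotProduct,
        dotProduct_hessianMatrix_quarticForm_mulVec_self]
      linarith
    rw [QuadraticMap.restrict_apply, ← hc, QuadraticMap.map_smul]
    exact mul_pos (mul_self_pos.2 hc0) hQp
  -- The kernel of `df/f` at `p` has dimension at least 2, and the Hessian form is negative definite
  -- on it.
  have hneg : 2 ≤ sigNeg Q := by
    let T : (Fin 3 → ℝ) →ₗ[ℝ] ℝ := ∑ l, (linearFactor l p)⁻¹ • (linearFactor l).toLinearMap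
    have hT : ∀ v, T v = ∑ l, linearFactor l v / linearFactor l p := fun v => by
      simp [T, div_eq_inv_mul]
    have hker : 2 ≤ Module.finrank ℝ T.ker := by
      have h1 := T.finrank_range_add_finrank_ker
      have h2 := T.range.finrank_le
      simp at h1 h2
      omega
    refine hker.trans (le_sigNeg_of_negDef Q fun v hv => ?_)
    have hv' : (v : Fin 3 → ℝ) ≠ 0 := by simpa using hv
    have := dotProduct_hessianMatrix_quarticForm_mulVec_neg hp hv' ((hT v).symm.trans v.2)
    simpa [hQ, toQuadraticForm'_apply_eq_dotProduct] using this
  -- The indices and the dimension of the radical add up to 3, so the two lower bounds are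
  -- equalities.
  have hsum := QuadraticForm.sigPos_add_sigNeg_add_radical (Q := Q)
  simp at hsum
  omega

lemma clebschCovariant_quarticForm :
    clebschCovariant quarticForm
        - 16 * (MvPolynomial.X 0 ^ 2 + MvPolynomial.X 1 ^ 2 + MvPolynomial.X 2 ^ 2
          + MvPolynomial.X 0 * MvPolynomial.X 1 + MvPolynomial.X 0 * MvPolynomial.X 2
          + MvPolynomial.X 1 * MvPolynomial.X 2) ^ 2
      = 48 * quarticForm := by
  simp [clebschCovariant, quarticForm, Derivation.leibniz, MvPolynomial.pderiv_X,
    smul_eq_mul]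
  ring

lemma unitLevel_quarticForm :
    unitLevel quarticForm = {p | MvPolynomial.eval p quarticForm = 1} := by
  ext p
  simp only [unitLevel, indexCone_quarticForm, Set.mem_ofPred_eq, ← eval_quarticForm]
  exact ⟨fun h => h.2, fun h => ⟨h ▸ one_pos, h⟩⟩

/-! ### Charts of the unit level -/

/-- A smooth map with a differentiable left inverse and relatively open image is a local
parametrization. -/
lemma isLocalParam_of_leftInvOn {n : ℕ} {M V : Set (Fin n → ℝ)} {U : Set (Fin 2 → ℝ)}
    {φ : (Fin 2 → ℝ) → (Fin n → ℝ)} {ψ : (Fin n → ℝ) → (Fin 2 → ℝ)} (hU : IsOpen U)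
    (hφ : ContDiffOn ℝ ∞ φ U) (hV : IsOpen V) (himg : φ '' U = M ∩ V)
    (hψ : ∀ u ∈ U, DifferentiableAt ℝ ψ (φ u)) (hinv : Set.LeftInvOn ψ φ U) :
    IsLocalParam M U φ where
  isOpen_domain := hU
  smooth := hφ
  immersion u hu := by
    have hd : DifferentiableAt ℝ φ u :=
      (hφ.contDiffAt (hU.mem_nhds hu)).differentiableAt (by simp)
    have hcomp : (fderiv ℝ ψ (φ u)).comp (fderiv ℝ φ u) = ContinuousLinearMap.id ℝ _ := by
      rw [← fderiv_comp u (hψ u hu) hd, ← fderiv_id (𝕜 := ℝ) (x := u)]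
      refine Filter.EventuallyEq.fderiv_eq ?_
      filter_upwards [hU.mem_nhds hu] with w hw using hinv hw
    exact Function.LeftInverse.injective (g := fderiv ℝ ψ (φ u)) fun v =>
      DFunLike.congr_fun hcomp v
  embedding := by
    refine ⟨Topology.isInducing_iff_nhds.2 fun u => le_antisymm ?_ ?_, ?_⟩
    -- One inequality is continuity of `φ`; the other is continuity of the left inverse `ψ` at `φ
    -- u`.
    · exact (hφ.continuousOn.domRestrict.tendsto u).le_comap
    · rw [nhds_subtype_eq_comap, ← Filter.map_le_iff_le_comap]
      have hlim := (hψ u u.2).continuousAt.tendsto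
      rw [hinv u.2] at hlim
      refine le_trans (le_of_eq ?_)
        (hlim.comp (Filter.tendsto_comap (f := U.domRestrict φ)))
      refine Filter.map_congr (Filter.Eventually.of_forall fun w => ?_)
      exact (hinv w.2).symm
    · exact fun u w h => Subtype.ext (hinv.injOn u.2 w.2 h)
  open_image := ⟨V, hV, himg⟩

/-- The quartic form on the affine plane `x = 1`. -/
def affineQuartic (u : Fin 2 → ℝ) : ℝ := u 0 * u 1 * (1 + u 0 + u 1)

/-- Radial projection of the affine plane `x = 1` to the part of the unit level with
`0 < ε * x`. -/
noncomputable def radialChart (ε : ℝ) (u : Fin 2 → ℝ) : Fin 3 → ℝ :=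
  fun a => ε * affineQuartic u ^ (-(1 / 4) : ℝ) * ![1, u 0, u 1] a

lemma contDiff_affineQuartic : ContDiff ℝ ∞ affineQuartic := by
  unfold affineQuartic
  fun_prop

lemma contDiffOn_radialChart (ε : ℝ) :
    ContDiffOn ℝ ∞ (radialChart ε) {u | 0 < affineQuartic u} := by
  refine contDiffOn_pi.2 fun a => ?_
  refine ContDiffOn.mul (contDiffOn_const.mul ?_) ?_
  · exact contDiff_affineQuartic.contDiffOn.rpow_const_of_ne fun u hu => ne_of_gt hu
  · refine ContDiff.contDiffOn ?_
    fin_cases a <;> simp <;> fun_prop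

/-- By homogeneity of degree 4, the ray through `ε (1, u₀, u₁)` meets `f = 1` exactly once when `f
(1, u₀, u₁) > 0`, at scale `f ^ (-1/4)`. Since `f` is even, both signs `ε = ±1` are allowed. -/
lemma image_radialChart {ε : ℝ} (hε : ε ^ 2 = 1) :
    radialChart ε '' {u | 0 < affineQuartic u} =
      unitLevel quarticForm ∩ {p | 0 < ε * p 0} := by
  have hr : ∀ u : Fin 2 → ℝ, 0 < affineQuartic u →
      0 < affineQuartic u ^ (-(1 / 4) : ℝ) := fun u hu => Real.rpow_pos_of_pos hu _
  have hr4 : ∀ u : Fin 2 → ℝ, 0 < affineQuartic u →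
      (affineQuartic u ^ (-(1 / 4) : ℝ)) ^ 4 * affineQuartic u = 1 := fun u hu => by
    rw [← Real.rpow_natCast, ← Real.rpow_mul hu.le]
    norm_num
    rw [Real.rpow_neg_one, inv_mul_cancel₀ hu.ne']
  ext p
  simp only [Set.mem_image, Set.mem_inter_iff, unitLevel_quarticForm, Set.mem_ofPred_eq,
    eval_quarticForm]
  constructor
  · rintro ⟨u, hu, rfl⟩
    refine ⟨?_, ?_⟩
    · have h := hr4 u hu
      simp only [radialChart, Matrix.cons_val]
      generalize affineQuartic u ^ (-(1 / 4) : ℝ) = r at h ⊢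
      simp only [affineQuartic] at h
      have hε4 : ε ^ 4 = 1 := by linear_combination (ε ^ 2 + 1) * hε
      linear_combination (r ^ 4 * (u 0 * u 1 * (1 + u 0 + u 1))) * hε4 + h
    · have := hr u hu
      simp only [radialChart, Matrix.cons_val]
      calc (0 : ℝ) < affineQuartic u ^ (-(1 / 4) : ℝ) := this
        _ = _ := by linear_combination -(affineQuartic u ^ (-(1 / 4) : ℝ)) * hε
  · rintro ⟨hp, hp0⟩
    have hne : p 0 ≠ 0 := by
      rintro h
      simp [h] at hp0
    -- The factor `ε` changes nothing in the fourth power, but makes the base positive, so that the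
    -- root below is `ε * p 0`.
    have hq : affineQuartic ![p 1 / p 0, p 2 / p 0] = ((ε * p 0) ^ 4)⁻¹ := by
      have hε4 : ε ^ 4 = 1 := by linear_combination (ε ^ 2 + 1) * hε
      simp only [affineQuartic, Matrix.cons_val]
      rw [mul_pow, hε4]
      field_simp
      linear_combination hp
    have hroot : affineQuartic ![p 1 / p 0, p 2 / p 0] ^ (-(1 / 4) : ℝ) = ε * p 0 := by
      rw [hq, Real.inv_rpow (by positivity), Real.rpow_neg (by positivity), inv_inv,
        ← Real.rpow_natCast, ← Real.rpow_mul hp0.le]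
      norm_num
    refine ⟨![p 1 / p 0, p 2 / p 0], ?_, ?_⟩
    · rw [hq]
      positivity
    · have hεε : ε * (ε * p 0) = p 0 := by linear_combination p 0 * hε
      ext a
      simp only [radialChart, hroot, hεε]
      fin_cases a
      · simp
      · simp [mul_div_cancel₀ _ hne]
      · simp [mul_div_cancel₀ _ hne]

lemma isLocalParam_radialChart {ε : ℝ} (hε : ε ^ 2 = 1) :
    IsLocalParam (unitLevel quarticForm) {u | 0 < affineQuartic u} (radialChart ε) := by
  have hε0 : ε ≠ 0 := by
    rintro rfl
    norm_num at hε
  have hr : ∀ u : Fin 2 → ℝ, 0 < affineQuartic u →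
      0 < affineQuartic u ^ (-(1 / 4) : ℝ) := fun u hu => Real.rpow_pos_of_pos hu _
  refine isLocalParam_of_leftInvOn (V := {p | 0 < ε * p 0})
    (ψ := fun p => ![p 1 / p 0, p 2 / p 0])
    (isOpen_lt continuous_const contDiff_affineQuartic.continuous)
    (contDiffOn_radialChart ε) (isOpen_lt continuous_const (by fun_prop))
    (image_radialChart hε) ?_ ?_
  · intro u hu
    have hne : radialChart ε u 0 ≠ 0 := by
      simp only [radialChart, Matrix.cons_val, mul_one]
      exact mul_ne_zero hε0 (hr u hu).ne'
    have hd (i : Fin 3) : DifferentiableAt ℝ (fun p : Fin 3 → ℝ => p i) (radialChart ε u) :=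
      differentiableAt_apply i _
    refine differentiableAt_pi.2 fun a => ?_
    fin_cases a
    · simpa [div_eq_mul_inv] using (hd 1).fun_mul ((hd 0).fun_inv hne)
    · simpa [div_eq_mul_inv] using (hd 2).fun_mul ((hd 0).fun_inv hne)
  · intro u hu
    have h := (hr u hu).ne'
    ext a
    fin_cases a <;> simp only [radialChart] <;> simp <;> norm_num at h <;> field_simp

/-- The first coordinate never vanishes where `f = 1`, so the two charts, one for each sign of it,
cover the surface. -/
lemma exists_isLocalParam_unitLevel_quarticForm {p : Fin 3 → ℝ}
    (hp : p ∈ unitLevel quarticForm) :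
    ∃ (U : Set (Fin 2 → ℝ)) (φ : (Fin 2 → ℝ) → (Fin 3 → ℝ)),
      IsLocalParam (unitLevel quarticForm) U φ ∧ p ∈ φ '' U := by
  have hp0 : p 0 ≠ 0 := by
    intro h
    simp [unitLevel_quarticForm, eval_quarticForm, h] at hp
  have hε : SignType.sign (p 0) * p 0 = |p 0| := sign_mul_self (p 0)
  have hε2 : ((SignType.sign (p 0) : ℝ)) ^ 2 = 1 := by
    rcases lt_or_gt_of_ne hp0 with h | h <;> simp [h]
  refine ⟨_, _, isLocalParam_radialChart hε2, ?_⟩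
  rw [image_radialChart hε2]
  exact ⟨hp, (abs_pos.2 hp0).trans_eq hε.symm⟩

/-! ### Partial derivatives of smooth functions -/

section PartialDeriv

variable {m : ℕ} {U : Set (Fin m → ℝ)} {u : Fin m → ℝ} {F G : (Fin m → ℝ) → ℝ}

lemma partialDeriv_congr (hU : IsOpen U) (hu : u ∈ U) (h : Set.EqOn F G U) (i : Fin m) :
    partialDeriv i F u = partialDeriv i G u := by
  unfold partialDeriv
  rw [Filter.EventuallyEq.fderiv_eq (h.eventuallyEq_of_mem (hU.mem_nhds hu))]

lemma ContDiffOn.differentiableAt_of_mem_open (hF : ContDiffOn ℝ ∞ F U) (hU : IsOpen U)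
    (hu : u ∈ U) : DifferentiableAt ℝ F u :=
  (hF.contDiffAt (hU.mem_nhds hu)).differentiableAt (by simp)

lemma ContDiffOn.partialDeriv (hF : ContDiffOn ℝ ∞ F U) (hU : IsOpen U) (i : Fin m) :
    ContDiffOn ℝ ∞ (partialDeriv i F) U :=
  (hF.fderiv_of_isOpen hU (by simp)).clm_apply contDiffOn_const

lemma partialDeriv_mul (hU : IsOpen U) (hu : u ∈ U) (hF : ContDiffOn ℝ ∞ F U)
    (hG : ContDiffOn ℝ ∞ G U) (i : Fin m) :
    partialDeriv i (fun w => F w * G w) u =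
      partialDeriv i F u * G u + F u * partialDeriv i G u := by
  unfold partialDeriv
  rw [fderiv_fun_mul (hF.differentiableAt_of_mem_open hU hu)
    (hG.differentiableAt_of_mem_open hU hu)]
  simp
  ring

lemma partialDeriv_add (hU : IsOpen U) (hu : u ∈ U) (hF : ContDiffOn ℝ ∞ F U)
    (hG : ContDiffOn ℝ ∞ G U) (i : Fin m) :
    partialDeriv i (fun w => F w + G w) u = partialDeriv i F u + partialDeriv i G u := by
  unfold partialDeriv
  rw [fderiv_fun_add (hF.differentiableAt_of_mem_open hU hu)
    (hG.differentiableAt_of_mem_open hU hu)]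
  simp

lemma partialDeriv_const_mul_sum {ι : Type*} [Fintype ι] (hU : IsOpen U) (hu : u ∈ U) (c : ℝ)
    {H : ι → (Fin m → ℝ) → ℝ} (hH : ∀ a, ContDiffOn ℝ ∞ (H a) U) (i : Fin m) :
    partialDeriv i (fun w => c * ∑ a, H a w) u = c * ∑ a, partialDeriv i (H a) u := by
  have hd : ∀ a ∈ Finset.univ, DifferentiableAt ℝ (H a) u := fun a _ =>
    (hH a).differentiableAt_of_mem_open hU hu
  unfold partialDeriv
  rw [fderiv_const_mul (DifferentiableAt.fun_sum hd), fderiv_fun_sum hd]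
  simp

lemma partialDeriv_comm (hU : IsOpen U) (hu : u ∈ U) (hF : ContDiffOn ℝ ∞ F U) (i j : Fin m) :
    partialDeriv i (partialDeriv j F) u = partialDeriv j (partialDeriv i F) u := by
  have hd : DifferentiableAt ℝ (fderiv ℝ F) u :=
    ((hF.fderiv_of_isOpen hU (m := ∞) (by simp)).contDiffAt
      (hU.mem_nhds hu)).differentiableAt (by simp)
  have key (k l : Fin m) : partialDeriv k (partialDeriv l F) u =
      fderiv ℝ (fderiv ℝ F) u (Pi.single k 1) (Pi.single l 1) := by
    change fderiv ℝ (fun w => fderiv ℝ F w (Pi.single l 1)) u (Pi.single k 1) = _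
    rw [fderiv_clm_apply hd (differentiableAt_const _)]
    simp
  rw [key, key]
  exact ((hF.contDiffAt (hU.mem_nhds hu)).isSymmSndFDerivAt
    (minSmoothness_of_isRCLikeNormedField.trans_le (WithTop.coe_le_coe.2 (le_top : (2 : ℕ∞) ≤ ⊤)))).eq _ _

end PartialDeriv

/-! ### Metrics induced from a Euclidean space -/

section Induced

variable {m : ℕ} {ι : Type*} [Fintype ι] {U : Set (Fin m → ℝ)}
  {g : (Fin m → ℝ) → Matrix (Fin m) (Fin m) ℝ} {c : ℝ} {ψ : ι → (Fin m → ℝ) → ℝ}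

lemma partialDeriv_induced (hU : IsOpen U) (hψ : ∀ a, ContDiffOn ℝ ∞ (ψ a) U)
    (hg : ∀ w ∈ U, ∀ i j, g w i j =
      c * ∑ a, partialDeriv i (ψ a) w * partialDeriv j (ψ a) w)
    {u : Fin m → ℝ} (hu : u ∈ U) (i j k : Fin m) :
    partialDeriv k (fun w => g w i j) u =
      c * ∑ a, (partialDeriv k (partialDeriv i (ψ a)) u * partialDeriv j (ψ a) u
        + partialDeriv i (ψ a) u * partialDeriv k (partialDeriv j (ψ a)) u) := by
  have h1 (a : ι) (i : Fin m) := (hψ a).partialDeriv hU i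
  rw [partialDeriv_congr hU hu (fun w hw => hg w hw i j) k,
    partialDeriv_const_mul_sum hU hu c (fun a => (h1 a i).mul (h1 a j))]
  simp_rw [fun a => partialDeriv_mul hU hu (h1 a i) (h1 a j) k]

lemma partialDeriv_partialDeriv_induced (hU : IsOpen U) (hψ : ∀ a, ContDiffOn ℝ ∞ (ψ a) U)
    (hg : ∀ w ∈ U, ∀ i j, g w i j =
      c * ∑ a, partialDeriv i (ψ a) w * partialDeriv j (ψ a) w)
    {u : Fin m → ℝ} (hu : u ∈ U) (i j k l : Fin m) :
    partialDeriv l (partialDeriv k (fun w => g w i j)) u =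
      c * ∑ a, (partialDeriv l (partialDeriv k (partialDeriv i (ψ a))) u
            * partialDeriv j (ψ a) u
          + partialDeriv k (partialDeriv i (ψ a)) u * partialDeriv l (partialDeriv j (ψ a)) u
        + (partialDeriv l (partialDeriv i (ψ a)) u * partialDeriv k (partialDeriv j (ψ a)) u
          + partialDeriv i (ψ a) u
            * partialDeriv l (partialDeriv k (partialDeriv j (ψ a))) u)) := by
  have h1 (a : ι) (i : Fin m) := (hψ a).partialDeriv hU i
  have h2 (a : ι) (i j : Fin m) := (h1 a i).partialDeriv hU j
  rw [partialDeriv_congr hU hu (fun w hw => partialDeriv_induced hU hψ hg hw i j k) l,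
    partialDeriv_const_mul_sum hU hu c
      (fun a => ((h2 a i k).mul (h1 a j)).add ((h1 a i).mul (h2 a j k)))]
  congr 1
  refine Finset.sum_congr rfl fun a _ => ?_
  rw [partialDeriv_add hU hu ((h2 a i k).mul (h1 a j)) ((h1 a i).mul (h2 a j k)),
    partialDeriv_mul hU hu (h2 a i k) (h1 a j), partialDeriv_mul hU hu (h1 a i) (h2 a j k)]

/-- Symmetry of second derivatives cancels four of the six products from the three metric
derivatives and makes the other two equal. -/
lemma christoffelFirst_induced (hU : IsOpen U) (hψ : ∀ a, ContDiffOn ℝ ∞ (ψ a) U)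
    (hg : ∀ w ∈ U, ∀ i j, g w i j =
      c * ∑ a, partialDeriv i (ψ a) w * partialDeriv j (ψ a) w)
    {u : Fin m → ℝ} (hu : u ∈ U) (i j k : Fin m) :
    christoffelFirst g i j k u =
      c * ∑ a, partialDeriv i (partialDeriv k (ψ a)) u * partialDeriv j (ψ a) u := by
  rw [christoffelFirst, partialDeriv_induced hU hψ hg hu, partialDeriv_induced hU hψ hg hu,
    partialDeriv_induced hU hψ hg hu]
  simp only [Finset.mul_sum, ← Finset.sum_add_distrib, ← Finset.sum_sub_distrib,
    Finset.sum_div]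
  refine Finset.sum_congr rfl fun a _ => ?_
  rw [partialDeriv_comm hU hu (hψ a) k i, partialDeriv_comm hU hu (hψ a) k j,
    partialDeriv_comm hU hu (hψ a) j i]
  ring

/-- The Gauss equation for a metric induced from a Euclidean space, in terms of the second
derivatives of the immersion. -/
lemma riemannTensor_induced (hU : IsOpen U) (hψ : ∀ a, ContDiffOn ℝ ∞ (ψ a) U)
    (hg : ∀ w ∈ U, ∀ i j, g w i j =
      c * ∑ a, partialDeriv i (ψ a) w * partialDeriv j (ψ a) w)
    {u : Fin m → ℝ} (hu : u ∈ U) (i j k l : Fin m) :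
    riemannTensor g i j k l u =
      c * ∑ a, (partialDeriv i (partialDeriv k (ψ a)) u * partialDeriv j (partialDeriv l (ψ a)) u
        - partialDeriv i (partialDeriv l (ψ a)) u * partialDeriv j (partialDeriv k (ψ a)) u)
      - ∑ p, ∑ q, (g u)⁻¹ p q *
        ((c * ∑ a, partialDeriv j (partialDeriv l (ψ a)) u * partialDeriv p (ψ a) u)
            * (c * ∑ a, partialDeriv i (partialDeriv k (ψ a)) u * partialDeriv q (ψ a) u)
          - (c * ∑ a, partialDeriv i (partialDeriv l (ψ a)) u * partialDeriv p (ψ a) u)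
            * (c * ∑ a, partialDeriv j (partialDeriv k (ψ a)) u * partialDeriv q (ψ a) u)) := by
  rw [riemannTensor]
  simp_rw [christoffelFirst_induced hU hψ hg hu]
  congr 1
  rw [partialDeriv_partialDeriv_induced hU hψ hg hu, partialDeriv_partialDeriv_induced hU hψ hg hu,
    partialDeriv_partialDeriv_induced hU hψ hg hu, partialDeriv_partialDeriv_induced hU hψ hg hu]
  simp only [Finset.mul_sum, ← Finset.sum_add_distrib, ← Finset.sum_sub_distrib,
    Finset.sum_div, ← Finset.sum_neg_distrib]
  refine Finset.sum_congr rfl fun a _ => ?_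
  -- Once mixed partials are put in a common order, all third derivatives cancel and only products
  -- of second derivatives remain.
  have hs (i j : Fin m) := partialDeriv_comm hU hu (hψ a) i j
  have ho (i j k : Fin m) := partialDeriv_comm hU hu ((hψ a).partialDeriv hU k) i j
  have hi (i j k : Fin m) :
      partialDeriv i (partialDeriv j (partialDeriv k (ψ a))) u =
        partialDeriv i (partialDeriv k (partialDeriv j (ψ a))) u :=
    partialDeriv_congr hU hu (fun w hw => partialDeriv_comm hU hw (hψ a) j k) i
  have ht (i j k : Fin m) :
      partialDeriv i (partialDeriv j (partialDeriv k (ψ a))) u =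
        partialDeriv k (partialDeriv j (partialDeriv i (ψ a))) u := by
    rw [ho i j k, hi j i k, ho j k i]
  rw [hi l j i, hi k i j, ht l j k, ht l i k, hs j i, hs l k, hs l i, hs k i, hs k j, hs l j]
  ring

end Induced

/-! ### Planes in `ℝ⁴` orthogonal to `(1, 1, 1, 1)` and to a vector of coordinate sum zero -/

/-- The Gram matrix of `S, T, x, 1` is block diagonal with nonzero determinant, so these vectors
form a basis of `ℝ⁴`; the coefficient of `1` vanishes on summing coordinates. -/
lemma exists_eq_combination_of_orthogonal {x S T A : Fin 4 → ℝ} (hx : ∑ l, x l = 0)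
    (hS : ∑ l, S l = 0) (hT : ∑ l, T l = 0) (hA : ∑ l, A l = 0) (hSx : S ⬝ᵥ x = 0)
    (hTx : T ⬝ᵥ x = 0) (hxx : x ⬝ᵥ x ≠ 0) (hD : (S ⬝ᵥ S) * (T ⬝ᵥ T) - (S ⬝ᵥ T) ^ 2 ≠ 0) :
    ∃ α β γ : ℝ, A = α • S + β • T + γ • x := by
  set M : Matrix (Fin 4) (Fin 4) ℝ := Matrix.of ![S, T, x, 1] with hM
  have hgram : M * Mᵀ = !![S ⬝ᵥ S, S ⬝ᵥ T, 0, 0; S ⬝ᵥ T, T ⬝ᵥ T, 0, 0;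
      0, 0, x ⬝ᵥ x, 0; 0, 0, 0, 4] := by
    have hentry (i j : Fin 4) : (M * Mᵀ) i j = ![S, T, x, 1] i ⬝ᵥ ![S, T, x, 1] j := rfl
    ext i j
    rw [hentry]
    fin_cases i <;> fin_cases j <;>
      simp [hSx, hTx, hx, hS, hT, one_dotProduct, dotProduct_one, dotProduct_comm x S, dotProduct_comm x T, dotProduct_comm T S]
  have hdet : M.det ≠ 0 := by
    intro h0
    have h1 := congrArg Matrix.det hgram
    rw [Matrix.det_mul, h0, zero_mul] at h1
    simp [Matrix.det_succ_row_zero, Fin.sum_univ_succ, Fin.succAbove] at h1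
    apply mul_ne_zero hD hxx
    linear_combination -(1 / 4) * h1
  have hc : (A ᵥ* M⁻¹) ᵥ* M = A := by
    rw [Matrix.vecMul_vecMul, Matrix.nonsing_inv_mul _ (isUnit_iff_ne_zero.2 hdet),
      Matrix.vecMul_one]
  generalize A ᵥ* M⁻¹ = c at hc
  have hl (l : Fin 4) : A l = c 0 * S l + c 1 * T l + c 2 * x l + c 3 := by
    rw [← hc]
    simp [hM, Matrix.vecMul, dotProduct, Fin.sum_univ_four]
  have hc3 : c 3 = 0 := by
    have h0 := hl 0
    have h1 := hl 1
    have h2 := hl 2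
    have h3 := hl 3
    simp only [Fin.sum_univ_four] at hx hS hT hA
    linear_combination (1 / 4) * (hA - h0 - h1 - h2 - h3 - c 0 * hS - c 1 * hT - c 2 * hx)
  exact ⟨c 0, c 1, c 2, funext fun l => by simp [hl l, hc3]⟩

/-- The scalar product of two vectors, through their components along and across the plane
spanned by `S` and `T`. -/
lemma gram_mul_dotProduct {x S T A : Fin 4 → ℝ} (B : Fin 4 → ℝ) (hx : ∑ l, x l = 0)
    (hS : ∑ l, S l = 0) (hT : ∑ l, T l = 0) (hA : ∑ l, A l = 0) (hSx : S ⬝ᵥ x = 0)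
    (hTx : T ⬝ᵥ x = 0) (hxx : x ⬝ᵥ x ≠ 0) (hD : (S ⬝ᵥ S) * (T ⬝ᵥ T) - (S ⬝ᵥ T) ^ 2 ≠ 0) :
    ((S ⬝ᵥ S) * (T ⬝ᵥ T) - (S ⬝ᵥ T) ^ 2) * (A ⬝ᵥ B) =
      ((S ⬝ᵥ S) * (T ⬝ᵥ T) - (S ⬝ᵥ T) ^ 2) * ((A ⬝ᵥ x) * (B ⬝ᵥ x) / (x ⬝ᵥ x))
      + ((T ⬝ᵥ T) * ((A ⬝ᵥ S) * (B ⬝ᵥ S))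
        - (S ⬝ᵥ T) * ((A ⬝ᵥ S) * (B ⬝ᵥ T) + (A ⬝ᵥ T) * (B ⬝ᵥ S))
        + (S ⬝ᵥ S) * ((A ⬝ᵥ T) * (B ⬝ᵥ T))) := by
  obtain ⟨α, β, γ, rfl⟩ := exists_eq_combination_of_orthogonal hx hS hT hA hSx hTx hxx hD
  simp only [add_dotProduct, smul_dotProduct, hSx, hTx, dotProduct_comm x S, dotProduct_comm x T,
    dotProduct_comm T S, dotProduct_comm B, smul_eq_mul]
  field_simp
  ring

/-- The determinant of the quadratic form `∑ x_l T_l²` on the plane orthogonal to `(1, 1, 1, 1)`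
and to `x`. -/
lemma det_weighted_mul_dotProduct_self {x S T : Fin 4 → ℝ} (hx : ∑ l, x l = 0)
    (hS : ∑ l, S l = 0) (hT : ∑ l, T l = 0) (hSx : S ⬝ᵥ x = 0) (hTx : T ⬝ᵥ x = 0) :
    ((∑ l, x l * S l * S l) * (∑ l, x l * T l * T l) - (∑ l, x l * S l * T l) ^ 2) * (x ⬝ᵥ x) =
      -4 * (∏ l, x l) * ((S ⬝ᵥ S) * (T ⬝ᵥ T) - (S ⬝ᵥ T) ^ 2) := by
  simp only [dotProduct, Fin.sum_univ_four, Fin.prod_univ_four] at *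
  have ex : x 3 = -(x 0 + x 1 + x 2) := by linear_combination hx
  have eS : S 3 = -(S 0 + S 1 + S 2) := by linear_combination hS
  have eT : T 3 = -(T 0 + T 1 + T 2) := by linear_combination hT
  rw [ex, eS] at hSx
  rw [ex, eT] at hTx
  rw [ex, eS, eT]
  clear ex eS eT hx hS hT
  generalize x 0 = x, x 1 = y, x 2 = z, S 0 = a, S 1 = b, S 2 = c, T 0 = d, T 1 = e,
    T 2 = f at *
  -- With the fourth coordinates eliminated, `n` has entries `x_i - x_3`, and orthogonality to `x`
  -- becomes orthogonality to `n` in `ℝ³`. Hence the cross product of `(a, b, c)` and `(d, e, f)` is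
  -- parallel to `n`, which is what `hc1`, `hc2`, `hc3` say.
  set n₁ := 2 * x + y + z with hn₁
  set n₂ := x + 2 * y + z with hn₂
  set n₃ := x + y + 2 * z with hn₃
  have h1 : a * n₁ + b * n₂ + c * n₃ = 0 := by linear_combination hSx
  have h2 : d * n₁ + e * n₂ + f * n₃ = 0 := by linear_combination hTx
  have hc1 : (n₁ ^ 2 + n₂ ^ 2 + n₃ ^ 2) * (b * f - c * e) =
      n₁ * (n₁ * (b * f - c * e) + n₂ * (c * d - a * f) + n₃ * (a * e - b * d)) := by
    linear_combination (n₃ * b - n₂ * c) * h2 + (n₂ * f - n₃ * e) * h1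
  have hc2 : (n₁ ^ 2 + n₂ ^ 2 + n₃ ^ 2) * (c * d - a * f) =
      n₂ * (n₁ * (b * f - c * e) + n₂ * (c * d - a * f) + n₃ * (a * e - b * d)) := by
    linear_combination (n₁ * c - n₃ * a) * h2 + (n₃ * d - n₁ * f) * h1
  have hc3 : (n₁ ^ 2 + n₂ ^ 2 + n₃ ^ 2) * (a * e - b * d) =
      n₃ * (n₁ * (b * f - c * e) + n₂ * (c * d - a * f) + n₃ * (a * e - b * d)) := by
    linear_combination (n₂ * a - n₁ * b) * h2 + (n₁ * e - n₂ * d) * h1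
  by_cases hN : n₁ ^ 2 + n₂ ^ 2 + n₃ ^ 2 = 0
  · have hs : n₁ = 0 ∧ n₂ = 0 ∧ n₃ = 0 := by
      refine ⟨?_, ?_, ?_⟩ <;> refine pow_eq_zero_iff two_ne_zero |>.1 ?_ <;>
        linarith only [hN, sq_nonneg n₁, sq_nonneg n₂, sq_nonneg n₃]
    obtain ⟨e1, e2, e3⟩ := hs
    have hx : x = 0 := by linarith
    have hy : y = 0 := by linarith
    have hz : z = 0 := by linarith
    simp [hx, hy, hz]
  · refine mul_left_cancel₀ (pow_ne_zero 2 hN) ?_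
    generalize hμ : n₁ * (b * f - c * e) + n₂ * (c * d - a * f) + n₃ * (a * e - b * d) = μ
      at hc1 hc2 hc3
    generalize hν : n₁ ^ 2 + n₂ ^ 2 + n₃ ^ 2 = ν at hc1 hc2 hc3 ⊢
    -- Cauchy–Binet: a weighted Gram determinant is the sum of `w_k w_l` times squared minors.
    -- Minors involving the fourth column are differences of cross product entries.
    have hW (w₁ w₂ w₃ w₄ : ℝ) :
        (w₁ * a * a + w₂ * b * b + w₃ * c * c + w₄ * -(a + b + c) * -(a + b + c))
            * (w₁ * d * d + w₂ * e * e + w₃ * f * f + w₄ * -(d + e + f) * -(d + e + f))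
          - (w₁ * a * d + w₂ * b * e + w₃ * c * f + w₄ * -(a + b + c) * -(d + e + f)) ^ 2 =
        w₁ * w₂ * (a * e - b * d) ^ 2 + w₁ * w₃ * (c * d - a * f) ^ 2
          + w₂ * w₃ * (b * f - c * e) ^ 2
          + w₁ * w₄ * ((c * d - a * f) - (a * e - b * d)) ^ 2
          + w₂ * w₄ * ((a * e - b * d) - (b * f - c * e)) ^ 2
          + w₃ * w₄ * ((b * f - c * e) - (c * d - a * f)) ^ 2 := by
      ring
    have hW1 := hW 1 1 1 1
    simp only [one_mul] at hW1
    rw [hW, hW1]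
    generalize b * f - c * e = c₁, c * d - a * f = c₂, a * e - b * d = c₃ at hc1 hc2 hc3 ⊢
    -- Replacing the cross product by its multiple of `n` leaves, up to the common factor `μ ^ 2`,
    -- an identity in `x, y, z` alone.
    have hQ (w₁ w₂ w₃ w₄ w₅ w₆ : ℝ) :
        ν ^ 2 * (w₁ * c₃ ^ 2 + w₂ * c₂ ^ 2 + w₃ * c₁ ^ 2 + w₄ * (c₂ - c₃) ^ 2
          + w₅ * (c₃ - c₁) ^ 2 + w₆ * (c₁ - c₂) ^ 2) =
        μ ^ 2 * (w₁ * n₃ ^ 2 + w₂ * n₂ ^ 2 + w₃ * n₁ ^ 2 + w₄ * (n₂ - n₃) ^ 2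
          + w₅ * (n₃ - n₁) ^ 2 + w₆ * (n₁ - n₂) ^ 2) := by
      calc _ = w₁ * (ν * c₃) ^ 2 + w₂ * (ν * c₂) ^ 2 + w₃ * (ν * c₁) ^ 2
            + w₄ * (ν * c₂ - ν * c₃) ^ 2 + w₅ * (ν * c₃ - ν * c₁) ^ 2
            + w₆ * (ν * c₁ - ν * c₂) ^ 2 := by ring
        _ = _ := by
          rw [hc1, hc2, hc3]
          ring
    have hQ1 := hQ 1 1 1 1 1 1
    simp only [one_mul] at hQ1
    rw [← mul_assoc, hQ, mul_left_comm, hQ1, hn₁, hn₂, hn₃]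
    ring

/-! ### Curvature of the unit level -/

section UnitLevel

variable {U : Set (Fin 2 → ℝ)} {φ : (Fin 2 → ℝ) → (Fin 3 → ℝ)}

lemma IsLocalParam.eval_quarticForm_eq_one (h : IsLocalParam (unitLevel quarticForm) U φ)
    {u : Fin 2 → ℝ} (hu : u ∈ U) : MvPolynomial.eval (φ u) quarticForm = 1 := by
  obtain ⟨V, -, hV⟩ := h.open_image
  have : φ u ∈ unitLevel quarticForm := (hV.subset (Set.mem_image_of_mem φ hu)).1
  rwa [unitLevel_quarticForm] at this

lemma IsLocalParam.linearFactor_ne_zero (h : IsLocalParam (unitLevel quarticForm) U φ)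
    {u : Fin 2 → ℝ} (hu : u ∈ U) (l : Fin 4) : linearFactor l (φ u) ≠ 0 :=
  _root_.linearFactor_ne_zero (by rw [h.eval_quarticForm_eq_one hu]; exact one_ne_zero) l

/-- The logarithms of the absolute values of the four linear factors along a parametrization. -/
noncomputable def logFactor (φ : (Fin 2 → ℝ) → (Fin 3 → ℝ)) (l : Fin 4) (u : Fin 2 → ℝ) : ℝ :=
  Real.log (linearFactor l (φ u))

lemma IsLocalParam.contDiffOn_linearFactor (h : IsLocalParam (unitLevel quarticForm) U φ)
    (l : Fin 4) : ContDiffOn ℝ ∞ (fun w => linearFactor l (φ w)) U :=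
  (linearFactor l).contDiff.comp_contDiffOn h.smooth

lemma IsLocalParam.contDiffOn_logFactor (h : IsLocalParam (unitLevel quarticForm) U φ)
    (l : Fin 4) : ContDiffOn ℝ ∞ (logFactor φ l) U :=
  (h.contDiffOn_linearFactor l).log fun _ hu => h.linearFactor_ne_zero hu l

lemma IsLocalParam.differentiableAt (h : IsLocalParam (unitLevel quarticForm) U φ)
    {u : Fin 2 → ℝ} (hu : u ∈ U) : DifferentiableAt ℝ φ u :=
  (h.smooth.contDiffAt (h.isOpen_domain.mem_nhds hu)).differentiableAt (by simp)

lemma IsLocalParam.fderiv_logFactor (h : IsLocalParam (unitLevel quarticForm) U φ)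
    {u : Fin 2 → ℝ} (hu : u ∈ U) (l : Fin 4) (v : Fin 2 → ℝ) :
    fderiv ℝ (logFactor φ l) u v = linearFactor l (fderiv ℝ φ u v) / linearFactor l (φ u) := by
  have hd : HasFDerivAt (fun w => linearFactor l (φ w)) ((linearFactor l).comp (fderiv ℝ φ u)) u :=
    (linearFactor l).hasFDerivAt.comp u (h.differentiableAt hu).hasFDerivAt
  have := (hd.log (h.linearFactor_ne_zero hu l)).fderiv
  change fderiv ℝ (fun w => Real.log (linearFactor l (φ w))) u v = _
  rw [this]
  simp [div_eq_inv_mul]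

lemma IsLocalParam.partialDeriv_linearFactor (h : IsLocalParam (unitLevel quarticForm) U φ)
    {u : Fin 2 → ℝ} (hu : u ∈ U) (l : Fin 4) (i : Fin 2) :
    partialDeriv i (fun w => linearFactor l (φ w)) u =
      linearFactor l (φ u) * partialDeriv i (logFactor φ l) u := by
  have hd : HasFDerivAt (fun w => linearFactor l (φ w)) ((linearFactor l).comp (fderiv ℝ φ u)) u :=
    (linearFactor l).hasFDerivAt.comp u (h.differentiableAt hu).hasFDerivAt
  rw [partialDeriv, partialDeriv, hd.fderiv, h.fderiv_logFactor hu,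
    mul_div_cancel₀ _ (h.linearFactor_ne_zero hu l)]
  rfl

lemma IsLocalParam.sum_fderiv_logFactor (h : IsLocalParam (unitLevel quarticForm) U φ)
    {u : Fin 2 → ℝ} (hu : u ∈ U) (v : Fin 2 → ℝ) :
    ∑ l, fderiv ℝ (logFactor φ l) u v = 0 := by
  have hd : ∀ l ∈ Finset.univ, DifferentiableAt ℝ (logFactor φ l) u := fun l _ =>
    (h.contDiffOn_logFactor l).differentiableAt_of_mem_open h.isOpen_domain hu
  -- `Real.log` is the logarithm of the absolute value, so the product `-1` of the factors has
  -- logarithm 0.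
  have hconst : (fun w => ∑ l, logFactor φ l w) =ᶠ[nhds u] fun _ => 0 := by
    filter_upwards [h.isOpen_domain.mem_nhds hu] with w hw
    have h1 := h.eval_quarticForm_eq_one hw
    rw [eval_quarticForm_eq_neg_prod, neg_eq_iff_eq_neg] at h1
    simp only [logFactor]
    rw [← Real.log_prod fun l _ => h.linearFactor_ne_zero hw l, h1]
    simp
  have := hconst.fderiv_eq (𝕜 := ℝ)
  rw [fderiv_fun_sum hd] at this
  simpa using DFunLike.congr_fun this v

lemma IsLocalParam.sum_partialDeriv_logFactor (h : IsLocalParam (unitLevel quarticForm) U φ)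
    {u : Fin 2 → ℝ} (hu : u ∈ U) (i : Fin 2) : ∑ l, partialDeriv i (logFactor φ l) u = 0 :=
  h.sum_fderiv_logFactor hu _

lemma IsLocalParam.sum_partialDeriv_partialDeriv_logFactor
    (h : IsLocalParam (unitLevel quarticForm) U φ) {u : Fin 2 → ℝ} (hu : u ∈ U) (i j : Fin 2) :
    ∑ l, partialDeriv j (partialDeriv i (logFactor φ l)) u = 0 := by
  have hs := partialDeriv_const_mul_sum h.isOpen_domain hu 1
    (fun l => (h.contDiffOn_logFactor l).partialDeriv h.isOpen_domain i) j
  rw [one_mul] at hs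
  rw [← hs, partialDeriv_congr (G := fun _ => 0) h.isOpen_domain hu fun w hw => by
    simp [h.sum_partialDeriv_logFactor hw i]]
  simp [partialDeriv]

/-- The derivative of `∑ l = 0`: the vector of linear factors is normal to the immersion by
logarithms. -/
lemma IsLocalParam.sum_partialDeriv_logFactor_mul
    (h : IsLocalParam (unitLevel quarticForm) U φ) {u : Fin 2 → ℝ} (hu : u ∈ U) (i : Fin 2) :
    ∑ l, partialDeriv i (logFactor φ l) u * linearFactor l (φ u) = 0 := by
  rw [← sum_linearFactor (fderiv ℝ φ u (Pi.single i 1))]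
  refine Finset.sum_congr rfl fun l _ => ?_
  rw [partialDeriv, h.fderiv_logFactor hu, div_mul_cancel₀ _ (h.linearFactor_ne_zero hu l)]

/-- Differentiating the orthogonality relation expresses the unnormalized second fundamental form
through first derivatives. -/
lemma IsLocalParam.sum_partialDeriv_partialDeriv_logFactor_mul
    (h : IsLocalParam (unitLevel quarticForm) U φ) {u : Fin 2 → ℝ} (hu : u ∈ U) (i j : Fin 2) :
    ∑ l, partialDeriv j (partialDeriv i (logFactor φ l)) u * linearFactor l (φ u) =
      -∑ l, linearFactor l (φ u) * partialDeriv i (logFactor φ l) u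
        * partialDeriv j (logFactor φ l) u := by
  have h1 (l : Fin 4) := (h.contDiffOn_logFactor l).partialDeriv h.isOpen_domain i
  have hs := partialDeriv_const_mul_sum h.isOpen_domain hu 1
    (fun l => (h1 l).mul (h.contDiffOn_linearFactor l)) j
  rw [partialDeriv_congr (G := fun _ => 0) h.isOpen_domain hu fun w hw => by
    simp [h.sum_partialDeriv_logFactor_mul hw i]] at hs
  simp_rw [partialDeriv_mul h.isOpen_domain hu (h1 _) (h.contDiffOn_linearFactor _),
    h.partialDeriv_linearFactor hu, Finset.sum_add_distrib] at hs
  have h0 : partialDeriv j (fun _ : Fin 2 → ℝ => (0 : ℝ)) u = 0 := by simp [partialDeriv]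
  rw [h0, one_mul] at hs
  rw [eq_neg_iff_add_eq_zero, hs]
  congr 1
  exact Finset.sum_congr rfl fun l _ => by ring

lemma dotProduct_hessianMetric_quarticForm_mulVec {p a b : Fin 3 → ℝ}
    (hp : MvPolynomial.eval p quarticForm = 1)
    (ha : ∑ l, linearFactor l a / linearFactor l p = 0) :
    a ⬝ᵥ hessianMetric 4 quarticForm p *ᵥ b =
      1 / 12 * ∑ l, linearFactor l a / linearFactor l p
        * (linearFactor l b / linearFactor l p) := by
  rw [hessianMetric, Matrix.smul_mulVec, dotProduct_smul,
    dotProduct_hessianMatrix_quarticForm_mulVec (by simp [hp]), hp, ha]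
  norm_num

lemma pullbackMetric_apply {m n : ℕ} (g : (Fin n → ℝ) → Matrix (Fin n) (Fin n) ℝ)
    (φ : (Fin m → ℝ) → (Fin n → ℝ)) (u : Fin m → ℝ) (i j : Fin m) :
    pullbackMetric g φ u i j =
      fderiv ℝ φ u (Pi.single i 1) ⬝ᵥ g (φ u) *ᵥ fderiv ℝ φ u (Pi.single j 1) := by
  rw [pullbackMetric, Matrix.mul_assoc]
  rfl

lemma IsLocalParam.pullbackMetric_hessianMetric (h : IsLocalParam (unitLevel quarticForm) U φ)
    {u : Fin 2 → ℝ} (hu : u ∈ U) (i j : Fin 2) :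
    pullbackMetric (hessianMetric 4 quarticForm) φ u i j =
      1 / 12 * ∑ l, partialDeriv i (logFactor φ l) u * partialDeriv j (logFactor φ l) u := by
  have ht := h.sum_fderiv_logFactor hu (Pi.single i 1)
  simp_rw [h.fderiv_logFactor hu] at ht
  rw [pullbackMetric_apply,
    dotProduct_hessianMetric_quarticForm_mulVec (h.eval_quarticForm_eq_one hu) ht]
  simp_rw [partialDeriv, h.fderiv_logFactor hu]

lemma jacobian_mulVec {m n : ℕ} (φ : (Fin m → ℝ) → (Fin n → ℝ)) (u v : Fin m → ℝ) :
    jacobian φ u *ᵥ v = fderiv ℝ φ u v := by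
  have hv : v = ∑ i, v i • Pi.single i (1 : ℝ) := by
    simpa using (pi_eq_sum_univ' v)
  conv_rhs => rw [hv]
  ext a
  simp [jacobian, Matrix.mulVec, dotProduct, mul_comm]

lemma isRiemannianOn_hessianMetric_quarticForm :
    IsRiemannianOn (hessianMetric 4 quarticForm) (unitLevel quarticForm) := by
  intro U φ h u hu
  refine Matrix.posDef_iff_dotProduct_mulVec.2 ⟨?_, fun v hv => ?_⟩
  · ext i j
    simp only [Matrix.conjTranspose_apply, star_trivial, h.pullbackMetric_hessianMetric hu]
    simp_rw [mul_comm (partialDeriv j _ _)]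
  · have hv' : fderiv ℝ φ u v ≠ 0 := fun h0 =>
      hv (h.immersion u hu (h0.trans (map_zero _).symm))
    have ht := h.sum_fderiv_logFactor hu v
    simp_rw [h.fderiv_logFactor hu] at ht
    have hneg := dotProduct_hessianMatrix_quarticForm_mulVec_neg
      (by rw [h.eval_quarticForm_eq_one hu]; exact one_pos) hv' ht
    rw [star_trivial, pullbackMetric, Matrix.mul_assoc, ← Matrix.mulVec_mulVec,
      ← Matrix.mulVec_mulVec, Matrix.dotProduct_mulVec, Matrix.vecMul_transpose,
      jacobian_mulVec, hessianMetric, Matrix.smul_mulVec, dotProduct_smul, smul_eq_mul]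
    exact mul_pos_of_neg_of_neg (by norm_num) hneg

lemma IsLocalParam.gaussianCurvature_quarticForm (h : IsLocalParam (unitLevel quarticForm) U φ)
    {u : Fin 2 → ℝ} (hu : u ∈ U) :
    gaussianCurvature (pullbackMetric (hessianMetric 4 quarticForm) φ) u =
      48 / (∑ l, linearFactor l (φ u) * linearFactor l (φ u)) ^ 2 := by
  have hpos := (isRiemannianOn_hessianMetric_quarticForm U φ h u hu).det_pos
  have hR := riemannTensor_induced h.isOpen_domain h.contDiffOn_logFactor
    (fun w hw => h.pullbackMetric_hessianMetric hw) hu 0 1 0 1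
  have hg (i j : Fin 2) := h.pullbackMetric_hessianMetric hu i j
  set T : Fin 2 → Fin 4 → ℝ := fun i l => partialDeriv i (logFactor φ l) u with hT
  set W : Fin 2 → Fin 2 → Fin 4 → ℝ :=
    fun i j l => partialDeriv i (partialDeriv j (logFactor φ l)) u with hW
  set x : Fin 4 → ℝ := fun l => linearFactor l (φ u) with hx
  have hWs : W 1 0 = W 0 1 := funext fun l =>
    partialDeriv_comm h.isOpen_domain hu (h.contDiffOn_logFactor l) 1 0
  have hg' (i j : Fin 2) : pullbackMetric (hessianMetric 4 quarticForm) φ u i j =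
      1 / 12 * (T i ⬝ᵥ T j) := hg i j
  have hTT : T 1 ⬝ᵥ T 0 = T 0 ⬝ᵥ T 1 := dotProduct_comm _ _
  have hx0 : ∑ l, x l = 0 := sum_linearFactor _
  have hT0 (i) : ∑ l, T i l = 0 := h.sum_partialDeriv_logFactor hu i
  have hTx (i) : T i ⬝ᵥ x = 0 := h.sum_partialDeriv_logFactor_mul hu i
  -- The indices are swapped because `W i j` applies `∂_j` first.
  have hW0 (i j) : ∑ l, W i j l = 0 := h.sum_partialDeriv_partialDeriv_logFactor hu j i
  have hWx (i j) : W i j ⬝ᵥ x = -∑ l, x l * T j l * T i l :=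
    h.sum_partialDeriv_partialDeriv_logFactor_mul hu j i
  have hprod : ∏ l, x l = -1 := by
    have := h.eval_quarticForm_eq_one hu
    rw [eval_quarticForm_eq_neg_prod] at this
    linarith
  have hxx : x ⬝ᵥ x ≠ 0 := fun h0 => by
    have := congrFun (dotProduct_self_eq_zero.1 h0) 0
    exact h.linearFactor_ne_zero hu 0 this
  rw [Matrix.det_fin_two, hg', hg', hg', hg', hTT] at hpos
  have hD : (T 0 ⬝ᵥ T 0) * (T 1 ⬝ᵥ T 1) - (T 0 ⬝ᵥ T 1) ^ 2 ≠ 0 := by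
    intro h0
    linarith
  have hB := det_weighted_mul_dotProduct_self hx0 (hT0 0) (hT0 1) (hTx 0) (hTx 1)
  -- The second derivatives are split into tangential and normal parts; the tangential ones will
  -- cancel the Christoffel terms.
  have hG1 := gram_mul_dotProduct (W 0 0) hx0 (hT0 0) (hT0 1) (hW0 1 1) (hTx 0) (hTx 1) hxx hD
  have hG2 := gram_mul_dotProduct (W 0 1) hx0 (hT0 0) (hT0 1) (hW0 0 1) (hTx 0) (hTx 1) hxx hD
  have hWW : ∑ l, (W 0 0 l * W 1 1 l - W 0 1 l * W 1 0 l) =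
      W 1 1 ⬝ᵥ W 0 0 - W 0 1 ⬝ᵥ W 0 1 := by
    rw [Finset.sum_sub_distrib, hWs, dotProduct_comm (W 1 1)]
    rfl
  set g := pullbackMetric (hessianMetric 4 quarticForm) φ with hgdef
  change riemannTensor g 0 1 0 1 u = 1 / 12 * ∑ l, (W 0 0 l * W 1 1 l - W 0 1 l * W 1 0 l)
    - ∑ p, ∑ q, (g u)⁻¹ p q *
      (1 / 12 * (W 1 1 ⬝ᵥ T p) * (1 / 12 * (W 0 0 ⬝ᵥ T q))
        - 1 / 12 * (W 0 1 ⬝ᵥ T p) * (1 / 12 * (W 1 0 ⬝ᵥ T q))) at hR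
  have hinv : (g u)⁻¹ =
      (12 / ((T 0 ⬝ᵥ T 0) * (T 1 ⬝ᵥ T 1) - (T 0 ⬝ᵥ T 1) ^ 2)) •
        !![T 1 ⬝ᵥ T 1, -(T 0 ⬝ᵥ T 1); -(T 0 ⬝ᵥ T 1), T 0 ⬝ᵥ T 0] := by
    refine Matrix.inv_eq_right_inv ?_
    ext i j
    fin_cases i <;> fin_cases j <;>
      simp [Matrix.mul_apply, Fin.sum_univ_two, hg', hTT] <;> field_simp <;> ring
  rw [gaussianCurvature, hR, hWW, hinv, hWs]
  simp only [hg', Fin.sum_univ_two, Matrix.smul_apply, smul_eq_mul, Matrix.of_apply,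
    Matrix.cons_val]
  have hWx' (i j) : W i j ⬝ᵥ x = -∑ l, x l * T i l * T j l := by
    rw [hWx]
    exact congrArg _ (Finset.sum_congr rfl fun l _ => by ring)
  simp only [hWx'] at hG1 hG2
  change _ = 48 / (x ⬝ᵥ x) ^ 2
  rw [hprod] at hB
  clear_value g T W x
  generalize (∑ l, x l * T 0 l * T 0 l) = b₀, (∑ l, x l * T 0 l * T 1 l) = b₁,
    (∑ l, x l * T 1 l * T 1 l) = b₂, x ⬝ᵥ x = q, T 0 ⬝ᵥ T 0 = g₀, T 0 ⬝ᵥ T 1 = g₁,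
    T 1 ⬝ᵥ T 1 = g₂ at *
  set D := g₀ * g₂ - g₁ ^ 2 with hDdef
  have hdet : 1 / 12 * g₀ * (1 / 12 * g₂) - (1 / 12 * g₁) ^ 2 = D / 144 := by
    rw [hDdef]
    ring
  have hB' : b₀ * b₂ - b₁ ^ 2 = 4 * D / q := by
    rw [eq_div_iff hxx]
    linarith
  -- Only the normal parts survive in the difference of `hG1` and `hG2`: they give `D * (b₀ * b₂ -
  -- b₁ ^ 2) / q`, evaluated by `hB'`.
  have key : D * (W 1 1 ⬝ᵥ W 0 0 - W 0 1 ⬝ᵥ W 0 1)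
      - (g₂ * (W 1 1 ⬝ᵥ T 0 * W 0 0 ⬝ᵥ T 0 - (W 0 1 ⬝ᵥ T 0) ^ 2)
        - g₁ * (W 1 1 ⬝ᵥ T 0 * W 0 0 ⬝ᵥ T 1 + W 1 1 ⬝ᵥ T 1 * W 0 0 ⬝ᵥ T 0
          - 2 * (W 0 1 ⬝ᵥ T 0 * W 0 1 ⬝ᵥ T 1))
        + g₀ * (W 1 1 ⬝ᵥ T 1 * W 0 0 ⬝ᵥ T 1 - (W 0 1 ⬝ᵥ T 1) ^ 2)) =
      4 * D ^ 2 / q ^ 2 := by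
    have : D * (4 * D / q) / q = 4 * D ^ 2 / q ^ 2 := by
      field_simp
    rw [← this, ← hB']
    linear_combination hG1 - hG2
  rw [hdet]
  have h48 : 48 / q ^ 2 * (D / 144) = 1 / 12 * (4 * D ^ 2 / q ^ 2) / D := by
    field_simp
    norm_num
  rw [div_eq_iff (by positivity), h48, ← key]
  clear_value D
  field_simp
  ring

lemma exists_hasGaussianCurvatureAt_quarticForm {p : Fin 3 → ℝ}
    (hp : p ∈ unitLevel quarticForm) :
    ∃ κ : ℝ, 0 < κ ∧
      HasGaussianCurvatureAt (hessianMetric 4 quarticForm) (unitLevel quarticForm) p κ := by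
  refine ⟨48 / (∑ l, linearFactor l p * linearFactor l p) ^ 2, ?_,
    exists_isLocalParam_unitLevel_quarticForm hp, ?_⟩
  · have hne : MvPolynomial.eval p quarticForm ≠ 0 := by
      rw [unitLevel_quarticForm] at hp
      exact ne_of_eq_of_ne hp one_ne_zero
    have : 0 < ∑ l, linearFactor l p * linearFactor l p :=
      Finset.sum_pos (fun l _ => mul_self_pos.2 (linearFactor_ne_zero hne l))
        Finset.univ_nonempty
    positivity
  · rintro U φ h u hu rfl
    exact h.gaussianCurvature_quarticForm hu

end UnitLevel

theorem lemma4p1 :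
    (indexCone quarticForm).Nonempty ∧
    indexCone quarticForm = {p | 0 < p 0 * p 1 * p 2 * (p 0 + p 1 + p 2)} ∧
    (unitLevel quarticForm).Nonempty ∧
    IsSmoothSurface (unitLevel quarticForm) ∧
    IsRiemannianOn (hessianMetric 4 quarticForm) (unitLevel quarticForm) ∧
    (∀ p ∈ unitLevel quarticForm, ∃ κ : ℝ, 0 < κ ∧
      HasGaussianCurvatureAt (hessianMetric 4 quarticForm) (unitLevel quarticForm) p κ) ∧
    clebschCovariant quarticForm
        - 16 * (MvPolynomial.X 0 ^ 2 + MvPolynomial.X 1 ^ 2 + MvPolynomial.X 2 ^ 2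
          + MvPolynomial.X 0 * MvPolynomial.X 1 + MvPolynomial.X 0 * MvPolynomial.X 2
          + MvPolynomial.X 1 * MvPolynomial.X 2) ^ 2
      = 48 * quarticForm := by
  have hlevel : (unitLevel quarticForm).Nonempty := by
    -- With `x = y = 1/2` the equation `f = 1` becomes `z ^ 2 + z = 4`.
    refine ⟨![1 / 2, 1 / 2, (-1 + Real.sqrt 17) / 2], ?_⟩
    rw [unitLevel_quarticForm, Set.mem_ofPred_eq, eval_quarticForm]
    simp only [Matrix.cons_val]
    linear_combination (1 / 16) * Real.sq_sqrt (show (0 : ℝ) ≤ 17 by norm_num)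
  exact ⟨hlevel.mono fun _ hp => hp.1, indexCone_quarticForm, hlevel,
    fun _ hp => exists_isLocalParam_unitLevel_quarticForm hp,
    isRiemannianOn_hessianMetric_quarticForm,
    fun _ hp => exists_hasGaussianCurvatureAt_quarticForm hp, clebschCovariant_quarticForm⟩
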